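/- Let $\mathbb T^2=(\mathbb R/\mathbb Z)^2$ with normalized Lebesgue measure. For $k\in\mathbb N$ let $I_k=[0,2^{-k}]$, regarded as a subset of $\mathbb R/\mathbb Z$. For $k,\ell\in\mathbb N$ and $u\in\mathbb T^2$ put $$ \phi_{k,\ell}(u)=\frac{\mathbf 1_{I_k\times I_\ell}(u)}{|I_k\times I_\ell|}-\frac{\mathbf 1_{(I_k\cap I_\ell)\times(I_k\cap I_\ell)}(u)}{|(I_k\cap I_\ell)\times(I_k\cap I_\ell)|}, $$ and let $K_{k,\ell}(u,v)=\phi_{k,\ell}(u)\,\phi_{k,\ell}(v)$ for $u,v\in\mathbb T^2$. For (real- or complex-valued) $f,h\in L^1(\mathbb T^2)$ and $x\in\mathbb T^2$ define $$ T_{k,\ell}(f,h)(x)=\iint_{\mathbb T^2\times\mathbb T^2}K_{k,\ell}(x-y,x-z)\,f(y)\,h(z)\,dy\,dz . $$ Then there exist functions $f_0,h_0\in L^1(\mathbb T^2)$ such that $$ \limsup_{\min(k,\ell)\to\infty}\bigl|T_{k,\ell}(f_0,h_0)(x)\bigr|=\infty $$ for all $x$ in a set of positive measure. In particular, the Lebesgue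 differentiation property $$ \lim_{\min(k,\ell)\to\infty}T_{k,\ell}(f,h)(x)=0\quad\text{for a.e. }x\in\mathbb T^2 $$ fails for $(f,h)=(f_0,h_0)$, hence it fails on $L^1(\mathbb T^2)\times L^1(\mathbb T^2)$. -/

import Mathlib

namespace TorusAverages

open MeasureTheory

noncomputable section

/-- The two-dimensional torus `(ℝ/ℤ)²`; its `volume` is normalized Lebesgue measure. -/
abbrev Torus2 : Type := UnitAddCircle × UnitAddCircle

/-- The dyadic interval `[0, 2^{-k}]`, seen as a subset of the circle `ℝ/ℤ`. -/
def dyadicInterval (k : ℕ) : Set UnitAddCircle :=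
  (fun t : ℝ => (t : UnitAddCircle)) '' Set.Icc (0 : ℝ) ((2 : ℝ)⁻¹ ^ k)

/-- The dyadic rectangle `I_k × I_ℓ`. -/
def rect (k l : ℕ) : Set Torus2 :=
  dyadicInterval k ×ˢ dyadicInterval l

/-- The dyadic square `(I_k ∩ I_ℓ) × (I_k ∩ I_ℓ)`. -/
def square (k l : ℕ) : Set Torus2 :=
  (dyadicInterval k ∩ dyadicInterval l) ×ˢ (dyadicInterval k ∩ dyadicInterval l)

/-- The `L¹`-normalized indicator function `1_A / |A|`. -/
def normalizedIndicator (A : Set Torus2) (u : Torus2) : ℝ :=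
  A.indicator (fun _ => (1 : ℝ)) u / volume.real A

/-- The bilinear kernel `K_{k,ℓ}(u, v)`. -/
def kernel (k l : ℕ) (u v : Torus2) : ℝ :=
  (normalizedIndicator (rect k l) u - normalizedIndicator (square k l) u) *
    (normalizedIndicator (rect k l) v - normalizedIndicator (square k l) v)

/-- `T_{k,ℓ}(f,h)(x) = ∬ K_{k,ℓ}(x - y, x - z) f(y) h(z) dy dz`. -/
def bilinearOp {𝕜 : Type*} [RCLike 𝕜] (k l : ℕ) (f h : Torus2 → 𝕜) (x : Torus2) : 𝕜 :=
  ∫ p : Torus2 × Torus2, (kernel k l (x - p.1) (x - p.2) : 𝕜) * f p.1 * h p.2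

/-- The mode of convergence `min (k, ℓ) → ∞` for pairs of indices. -/
def minAtTop : Filter (ℕ × ℕ) :=
  Filter.comap (fun p : ℕ × ℕ => min p.1 p.2) Filter.atTop

end

end TorusAverages

namespace TorusAverages

open MeasureTheory Filter Topology Metric
open scoped ENNReal

/-! The kernel is a tensor product, so for real `f = h` the operator is the square of the difference
between the rectangle and the square average of `f`. Square averages converge a.e.
(`ae_tendsto_mean_square`), so it suffices that strong averages of some integrable `f` are unbounded
on a set of positive measure. A unit mass on a tiny square has average `2 ^ m` over any rectangle of
area `2⁻¹ ^ m` that swallows the square. The `M` admissible shapes of that area serve essentially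
disjoint sets of points, whose union has measure about `M * 2⁻¹ ^ m`: a gain of `M` over a single
shape (`le_volume_hyperbolicCross`). Well-chosen translates cover almost the whole torus at a total
mass of order `V / M` for height `V` (`exists_small_integral_large_mean`). Summing such functions
over heights `j` gives `f`. -/

lemma dyadicInterval_eq_closedBall (k : ℕ) :
    dyadicInterval k =
      closedBall (((2 : ℝ)⁻¹ ^ k / 2 : ℝ) : UnitAddCircle) ((2 : ℝ)⁻¹ ^ k / 2) := by
  ext x
  obtain ⟨t, rfl⟩ := QuotientAddGroup.mk_surjective x
  have key := Set.ext_iff.1 (AddCircle.coe_real_preimage_closedBall_eq_iUnion (1 : ℝ)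
    ((2 : ℝ)⁻¹ ^ k / 2) ((2 : ℝ)⁻¹ ^ k / 2)) t
  refine Iff.trans ?_ key.symm
  simp only [Set.mem_iUnion, mem_closedBall, Real.dist_eq, abs_le, dyadicInterval, Set.mem_image,
    Set.mem_Icc, zsmul_eq_mul, mul_one]
  constructor
  · rintro ⟨s, ⟨h0, h1⟩, hs⟩
    obtain ⟨n, hn⟩ := (QuotientAddGroup.eq_iff_sub_mem.1 hs)
    simp only [zsmul_eq_mul, mul_one] at hn
    exact ⟨-n, by push_cast; linarith, by push_cast; linarith⟩
  · rintro ⟨n, h1, h2⟩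
    refine ⟨t - n, ⟨by linarith, by linarith⟩, ?_⟩
    refine QuotientAddGroup.eq_iff_sub_mem.2 ⟨-n, ?_⟩
    simp

lemma measurableSet_dyadicInterval (k : ℕ) : MeasurableSet (dyadicInterval k) := by
  rw [dyadicInterval_eq_closedBall]
  exact measurableSet_closedBall

lemma volume_dyadicInterval (k : ℕ) :
    volume (dyadicInterval k) = ENNReal.ofReal ((2 : ℝ)⁻¹ ^ k) := by
  rw [dyadicInterval_eq_closedBall, AddCircle.volume_closedBall, min_eq_right]
  · congr 1; ring
  · have : (2 : ℝ)⁻¹ ^ k ≤ 1 := pow_le_one₀ (by norm_num) (by norm_num)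
    linarith

lemma dyadicInterval_antitone : Antitone dyadicInterval := fun _ _ h =>
  Set.image_mono (Set.Icc_subset_Icc_right
    (pow_le_pow_of_le_one (by norm_num) (by norm_num) h))

lemma sub_mem_dyadicInterval {k n : ℕ} {s y : UnitAddCircle}
    (hs : s ∈ dyadicInterval k \ dyadicInterval n) (hy : y ∈ dyadicInterval n) :
    s - y ∈ dyadicInterval k := by
  obtain ⟨⟨t, ht, rfl⟩, hn⟩ := hs
  obtain ⟨r, hr, rfl⟩ := hy
  have htn : (2 : ℝ)⁻¹ ^ n < t := by
    by_contra! h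
    exact hn ⟨t, ⟨ht.1, h⟩, rfl⟩
  exact ⟨t - r, ⟨by linarith [hr.2], by linarith [ht.2, hr.1]⟩, rfl⟩

lemma measurableSet_rect (k l : ℕ) : MeasurableSet (rect k l) :=
  (measurableSet_dyadicInterval k).prod (measurableSet_dyadicInterval l)

lemma volume_real_rect (k l : ℕ) :
    volume.real (rect k l) = (2 : ℝ)⁻¹ ^ k * (2 : ℝ)⁻¹ ^ l := by
  rw [rect, measureReal_def, Measure.volume_eq_prod, Measure.prod_prod, volume_dyadicInterval,
    volume_dyadicInterval, ENNReal.toReal_mul, ENNReal.toReal_ofReal (by positivity),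
    ENNReal.toReal_ofReal (by positivity)]

lemma square_eq_rect (k l : ℕ) : square k l = rect (max k l) (max k l) := by
  have h : dyadicInterval k ∩ dyadicInterval l = dyadicInterval (max k l) := by
    rcases le_total k l with h | h
    · rw [max_eq_right h, Set.inter_eq_right.2 (dyadicInterval_antitone h)]
    · rw [max_eq_left h, Set.inter_eq_left.2 (dyadicInterval_antitone h)]
  rw [square, h, rect]

/-! ### Averages over rectangles -/

instance : (volume : Measure Torus2).IsAddHaarMeasure :=
  Measure.prod.instIsAddHaarMeasure _ _

/-- The average of `f` over `x - A`. -/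
noncomputable def mean (A : Set Torus2) (f : Torus2 → ℝ) (x : Torus2) : ℝ :=
  ∫ y, normalizedIndicator A (x - y) * f y

lemma normalizedIndicator_nonneg (A : Set Torus2) (u : Torus2) : 0 ≤ normalizedIndicator A u :=
  div_nonneg (Set.indicator_nonneg (fun _ _ => zero_le_one) u) measureReal_nonneg

lemma measurable_normalizedIndicator {A : Set Torus2} (hA : MeasurableSet A) :
    Measurable (normalizedIndicator A) :=
  (measurable_const.indicator hA).div_const _

lemma normalizedIndicator_of_mem {A : Set Torus2} {u : Torus2} (hu : u ∈ A) :
    normalizedIndicator A u = (volume.real A)⁻¹ := by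
  rw [normalizedIndicator, Set.indicator_of_mem hu, one_div]

lemma normalizedIndicator_of_notMem {A : Set Torus2} {u : Torus2} (hu : u ∉ A) :
    normalizedIndicator A u = 0 := by
  rw [normalizedIndicator, Set.indicator_of_notMem hu, zero_div]

lemma norm_normalizedIndicator_le (A : Set Torus2) (u : Torus2) :
    ‖normalizedIndicator A u‖ ≤ (volume.real A)⁻¹ := by
  rw [Real.norm_of_nonneg (normalizedIndicator_nonneg A u)]
  by_cases hu : u ∈ A
  · rw [normalizedIndicator_of_mem hu]
  · rw [normalizedIndicator_of_notMem hu]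
    exact inv_nonneg.2 measureReal_nonneg

lemma integrable_normalizedIndicator {A : Set Torus2} (hA : MeasurableSet A) :
    Integrable (normalizedIndicator A) :=
  ((integrable_const 1).indicator hA).div_const _

lemma integral_normalizedIndicator_rect (k l : ℕ) :
    ∫ u, normalizedIndicator (rect k l) u = 1 := by
  simp only [normalizedIndicator]
  rw [integral_div, integral_indicator_const _ (measurableSet_rect k l), smul_eq_mul, mul_one,
    div_self]
  rw [volume_real_rect]
  positivity

lemma integrable_mean {A : Set Torus2} (hA : MeasurableSet A) {f : Torus2 → ℝ}
    (hf : Integrable f) (x : Torus2) :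
    Integrable (fun y => normalizedIndicator A (x - y) * f y) :=
  hf.bdd_mul ((measurable_normalizedIndicator hA).comp
    (measurable_const.sub measurable_id)).aestronglyMeasurable
    (Eventually.of_forall fun y => norm_normalizedIndicator_le A (x - y))

lemma mean_mono {A : Set Torus2} (hA : MeasurableSet A) {f g : Torus2 → ℝ}
    (hf : Integrable f) (hg : Integrable g) (hfg : f ≤ᵐ[volume] g) (x : Torus2) :
    mean A f x ≤ mean A g x := by
  refine integral_mono_ae (integrable_mean hA hf x) (integrable_mean hA hg x) ?_
  filter_upwards [hfg] with y hy
  exact mul_le_mul_of_nonneg_left hy (normalizedIndicator_nonneg _ _)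

lemma mean_comp_sub (A : Set Torus2) (g : Torus2 → ℝ) (τ x : Torus2) :
    mean A (fun y => g (y - τ)) x = mean A g (x - τ) := by
  rw [mean, mean,
    ← integral_sub_right_eq_self (fun y => normalizedIndicator A (x - τ - y) * g y) τ]
  simp only [sub_sub_sub_cancel_right]

lemma mean_const_mul (A : Set Torus2) (c : ℝ) (g : Torus2 → ℝ) (x : Torus2) :
    mean A (fun y => c * g y) x = c * mean A g x := by
  rw [mean, mean, ← integral_const_mul]
  congr! 2
  ring

/-- The whole unit mass lies in the averaging rectangle, so the average is the reciprocal of the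
rectangle's area. -/
lemma mean_rect_normalizedIndicator {k l n : ℕ} {x : Torus2}
    (hx : ∀ y ∈ rect n n, x - y ∈ rect k l) :
    mean (rect k l) (normalizedIndicator (rect n n)) x = 2 ^ (k + l) := by
  have h : ∀ y, normalizedIndicator (rect k l) (x - y) * normalizedIndicator (rect n n) y =
      2 ^ (k + l) * normalizedIndicator (rect n n) y := by
    intro y
    by_cases hy : y ∈ rect n n
    · rw [normalizedIndicator_of_mem (hx y hy), volume_real_rect, ← pow_add, inv_pow, inv_inv]
    · rw [normalizedIndicator_of_notMem hy, mul_zero, mul_zero]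
  rw [mean, integral_congr_ae (Eventually.of_forall h), integral_const_mul,
    integral_normalizedIndicator_rect, mul_one]

lemma bilinearOp_ofReal {𝕜 : Type*} [RCLike 𝕜] (k l : ℕ) {f h : Torus2 → ℝ}
    (hf : Integrable f) (hh : Integrable h) (x : Torus2) :
    bilinearOp k l (fun y => (f y : 𝕜)) (fun y => (h y : 𝕜)) x =
      (((mean (rect k l) f x - mean (square k l) f x) *
        (mean (rect k l) h x - mean (square k l) h x) : ℝ) : 𝕜) := by
  have hs : MeasurableSet (square k l) := by
    rw [square_eq_rect]
    exact measurableSet_rect _ _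
  have key : ∀ {g : Torus2 → ℝ}, Integrable g →
      ∫ y, (normalizedIndicator (rect k l) (x - y) - normalizedIndicator (square k l) (x - y)) * g y
        = mean (rect k l) g x - mean (square k l) g x := by
    intro g hg
    rw [mean, mean, ← integral_sub (integrable_mean (measurableSet_rect k l) hg x)
      (integrable_mean hs hg x)]
    congr! 2
    ring
  rw [← key hf, ← key hh, ← integral_prod_mul, ← integral_ofReal, bilinearOp]
  refine integral_congr_ae (Eventually.of_forall fun p => ?_)
  simp only [kernel]
  push_cast
  ring

/-! ### Differentiation along squares -/

/-- The centre of the dyadic square `rect n n`. -/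
noncomputable def squareCenter (n : ℕ) : Torus2 :=
  (((2 : ℝ)⁻¹ ^ n / 2 : ℝ), ((2 : ℝ)⁻¹ ^ n / 2 : ℝ))

lemma sub_mem_rect_iff (n : ℕ) (x y : Torus2) :
    x - y ∈ rect n n ↔ y ∈ closedBall (x - squareCenter n) ((2 : ℝ)⁻¹ ^ n / 2) := by
  rw [squareCenter, rect, dyadicInterval_eq_closedBall, closedBall_prod_same, mem_closedBall, mem_closedBall,
    dist_eq_norm, dist_eq_norm, ← norm_neg]
  have h : ∀ a b c : Torus2, -(a - b - c) = b - (a - c) := fun a b c => by abel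
  rw [h]

/-- In the sup metric `x - rect n n` is a ball containing `x`, though not centred there;
differentiation for doubling measures allows such off-centre balls. -/
lemma ae_tendsto_mean_rect {f : Torus2 → ℝ} (hf : Integrable f) :
    ∀ᵐ x, Tendsto (fun n => mean (rect n n) f x) atTop (𝓝 (f x)) := by
  filter_upwards [IsUnifLocDoublingMeasure.ae_tendsto_average volume hf.locallyIntegrable 1]
    with x hx
  have hδ : Tendsto (fun n : ℕ => (2 : ℝ)⁻¹ ^ n / 2) atTop (𝓝[>] 0) := by
    refine tendsto_nhdsWithin_iff.2 ⟨?_, Eventually.of_forall fun n => by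
      simp only [Set.mem_Ioi]; positivity⟩
    simpa using (tendsto_pow_atTop_nhds_zero_of_lt_one (r := (2 : ℝ)⁻¹) (by norm_num)
      (by norm_num)).div_const 2
  have h0 : ∀ n, (0 : Torus2) ∈ rect n n := fun n =>
    ⟨⟨0, by simp, by simp⟩, ⟨0, by simp, by simp⟩⟩
  refine (hx (fun n : ℕ => x - squareCenter n) _ hδ
    (Eventually.of_forall fun n => ?_)).congr fun n => ?_
  · rw [one_mul, ← sub_mem_rect_iff, sub_self]
    exact h0 n
  · set B := closedBall (x - squareCenter n) ((2 : ℝ)⁻¹ ^ n / 2) with hB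
    have hvol : volume.real B = volume.real (rect n n) := by
      have hr : rect n n = closedBall (squareCenter n) ((2 : ℝ)⁻¹ ^ n / 2) := by
        rw [rect, dyadicInterval_eq_closedBall, closedBall_prod_same, squareCenter]
      rw [hr, hB, measureReal_def, measureReal_def, ← closedBall_prod_same,
        ← closedBall_prod_same, Measure.volume_eq_prod, Measure.prod_prod, Measure.prod_prod]
      simp only [AddCircle.volume_closedBall]
    rw [setAverage_eq, hvol, ← integral_indicator measurableSet_closedBall, smul_eq_mul,
      ← integral_const_mul, mean]
    refine integral_congr_ae (Eventually.of_forall fun y => ?_)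
    by_cases hy : x - y ∈ rect n n
    · simp only [normalizedIndicator_of_mem hy]
      rw [Set.indicator_of_mem ((sub_mem_rect_iff n x y).1 hy)]
    · simp only [normalizedIndicator_of_notMem hy]
      rw [Set.indicator_of_notMem (mt (sub_mem_rect_iff n x y).2 hy), mul_zero, zero_mul]

lemma tendsto_max_minAtTop : Tendsto (fun p : ℕ × ℕ => max p.1 p.2) minAtTop atTop :=
  tendsto_atTop_mono (fun _ => min_le_max) tendsto_comap

lemma ae_tendsto_mean_square {f : Torus2 → ℝ} (hf : Integrable f) :
    ∀ᵐ x, Tendsto (fun p : ℕ × ℕ => mean (square p.1 p.2) f x) minAtTop (𝓝 (f x)) := by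
  filter_upwards [ae_tendsto_mean_rect hf] with x hx
  simp only [square_eq_rect]
  exact hx.comp tendsto_max_minAtTop

/-! ### Covering the torus by translates of a hyperbolic cross -/

instance : IsProbabilityMeasure (volume : Measure Torus2) := by
  have : IsProbabilityMeasure (volume : Measure UnitAddCircle) :=
    ⟨by rw [AddCircle.measure_univ, ENNReal.ofReal_one]⟩
  exact inferInstanceAs (IsProbabilityMeasure
    ((volume : Measure UnitAddCircle).prod (volume : Measure UnitAddCircle)))

/-- First moment method: some translate of `B` misses at most a proportion `1 - |B|` of `A`. -/
lemma exists_translate_measureReal_diff_le {A B : Set Torus2} (hA : MeasurableSet A)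
    (hB : MeasurableSet B) :
    ∃ τ : Torus2, volume.real (A \ {x | x - τ ∈ B}) ≤ volume.real A * (1 - volume.real B) := by
  -- By Fubini and translation invariance the mean overlap is `|A| |B|`; some `τ` does at least as
  -- well.
  have hpr : ∫⁻ τ, volume (A ∩ {x | x + τ ∈ B}) = volume A * volume B := by
    have hS : MeasurableSet {p : Torus2 × Torus2 | p.1 ∈ A ∧ p.1 + p.2 ∈ B} :=
      (measurable_fst hA).inter ((measurable_fst.add measurable_snd) hB)
    have h1 := Measure.prod_apply (μ := (volume : Measure Torus2)) (ν := volume) hS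
    have h2 := Measure.prod_apply_symm (μ := (volume : Measure Torus2)) (ν := volume) hS
    have h3 : ∀ x : Torus2, volume (Prod.mk x ⁻¹' {p : Torus2 × Torus2 | p.1 ∈ A ∧ p.1 + p.2 ∈ B})
        = A.indicator (fun _ => volume B) x := by
      intro x
      by_cases hx : x ∈ A
      · rw [Set.indicator_of_mem hx, ← measure_preimage_add volume x B]
        congr 1
        ext y
        simp [hx]
      · rw [Set.indicator_of_notMem hx]
        simp [hx]
    rw [lintegral_congr h3, lintegral_indicator_const hA, h2] at h1
    rw [mul_comm, ← h1]
    rfl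
  obtain ⟨τ, hτ⟩ := exists_lintegral_le (μ := (volume : Measure Torus2))
    (f := fun τ => volume (A ∩ {x | x + τ ∈ B})) (by rw [hpr]; finiteness)
  rw [hpr] at hτ
  refine ⟨-τ, ?_⟩
  simp only [sub_neg_eq_add]
  have hmeas : MeasurableSet {x | x + τ ∈ B} := (measurable_id.add_const τ) hB
  have h4 := measureReal_inter_add_sdiff (μ := (volume : Measure Torus2)) (s := A) hmeas
  have h5 : volume.real A * volume.real B ≤ volume.real (A ∩ {x | x + τ ∈ B}) := by
    rw [measureReal_def, measureReal_def, ← ENNReal.toReal_mul]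
    exact ENNReal.toReal_mono (by finiteness) hτ
  linarith

/-- The points whose `L¹`-normalized averages over some `rect k l` with `k + l = 2 * N + M` see all
of the square `rect n n`, where `n = 2 * N + M + 1`. -/
def hyperbolicCross (N M : ℕ) : Set Torus2 :=
  ⋃ i ∈ Finset.range M,
    (dyadicInterval (N + i) \ dyadicInterval (N + i + 1)) ×ˢ
      (dyadicInterval (N + M - i) \ dyadicInterval (2 * N + M + 1))

lemma measurableSet_hyperbolicCross (N M : ℕ) : MeasurableSet (hyperbolicCross N M) :=
  Finset.measurableSet_biUnion _ fun _ _ =>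
    ((measurableSet_dyadicInterval _).diff (measurableSet_dyadicInterval _)).prod
      ((measurableSet_dyadicInterval _).diff (measurableSet_dyadicInterval _))

lemma volume_real_dyadicInterval_diff {k l : ℕ} (h : k ≤ l) :
    volume.real (dyadicInterval k \ dyadicInterval l) = (2 : ℝ)⁻¹ ^ k - (2 : ℝ)⁻¹ ^ l := by
  rw [measureReal_sdiff (dyadicInterval_antitone h) (measurableSet_dyadicInterval l),
    measureReal_def, measureReal_def, volume_dyadicInterval, volume_dyadicInterval,
    ENNReal.toReal_ofReal (by positivity), ENNReal.toReal_ofReal (by positivity)]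

/-- The pieces are disjoint because their first coordinates lie in different dyadic shells. Each
removal costs at most half a side, so each piece keeps a quarter of the area `2⁻¹ ^ (2 * N + M)`. -/
lemma le_volume_hyperbolicCross (N M : ℕ) :
    (M : ℝ) * (2 : ℝ)⁻¹ ^ (2 * N + M + 2) ≤ volume.real (hyperbolicCross N M) := by
  rw [hyperbolicCross, measureReal_biUnion_finset]
  · rw [← nsmul_eq_mul]
    nth_rw 1 [← Finset.card_range M]
    refine Finset.card_nsmul_le_sum _ _ _ fun i hi => ?_
    have hi := Finset.mem_range.1 hi
    rw [measureReal_def, Measure.volume_eq_prod, Measure.prod_prod, ENNReal.toReal_mul,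
      ← measureReal_def, ← measureReal_def, volume_real_dyadicInterval_diff (Nat.le_succ _),
      volume_real_dyadicInterval_diff (by omega)]
    have h1 : (2 : ℝ)⁻¹ ^ (2 * N + M + 1) ≤ (2 : ℝ)⁻¹ ^ (N + M - i + 1) :=
      pow_le_pow_of_le_one (by norm_num) (by norm_num) (by omega)
    have h2 : (2 : ℝ)⁻¹ ^ (2 * N + M + 2) =
        (2 : ℝ)⁻¹ ^ (N + i + 1) * (2 : ℝ)⁻¹ ^ (N + M - i + 1) := by
      rw [← pow_add]
      congr 1
      omega
    rw [h2]
    refine mul_le_mul ?_ ?_ (by positivity) ?_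
    · rw [pow_succ]; linarith
    · have := pow_succ (2 : ℝ)⁻¹ (N + M - i)
      linarith
    · have : (0 : ℝ) < (2 : ℝ)⁻¹ ^ (N + i) := by positivity
      rw [pow_succ]; linarith
  · intro i _ j _ hij
    refine Set.disjoint_left.2 fun x hx hy => ?_
    rcases lt_or_gt_of_ne hij with h | h
    · exact hx.1.2 (dyadicInterval_antitone (by omega) hy.1.1)
    · exact hy.1.2 (dyadicInterval_antitone (by omega) hx.1.1)
  · exact fun i _ => ((measurableSet_dyadicInterval _).diff (measurableSet_dyadicInterval _)).prod
      ((measurableSet_dyadicInterval _).diff (measurableSet_dyadicInterval _))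

lemma exists_mean_rect_eq {N M : ℕ} {x : Torus2} (hx : x ∈ hyperbolicCross N M) :
    ∃ k ≥ N, ∃ l ≥ N, mean (rect k l)
      (normalizedIndicator (rect (2 * N + M + 1) (2 * N + M + 1))) x = 2 ^ (2 * N + M) := by
  simp only [hyperbolicCross, Set.mem_iUnion, Finset.mem_range] at hx
  obtain ⟨i, hi, h1, h2⟩ := hx
  refine ⟨N + i, by omega, N + M - i, by omega, ?_⟩
  rw [mean_rect_normalizedIndicator, show N + i + (N + M - i) = 2 * N + M by omega]
  refine fun y hy => ⟨sub_mem_dyadicInterval ⟨h1.1, fun h => h1.2 ?_⟩ hy.1,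
    sub_mem_dyadicInterval h2 hy.2⟩
  exact dyadicInterval_antitone (by omega) h

/-- Superposing `L` well-chosen translates of `g` covers all but a proportion `(1 - |B|) ^ L` of the
torus by points where some average of `g` is large. -/
lemma exists_sum_translates {g : Torus2 → ℝ} (hg : Integrable g) (hg0 : 0 ≤ g) {B : Set Torus2}
    (hB : MeasurableSet B) {N : ℕ} {V : ℝ}
    (hgB : ∀ x ∈ B, ∃ k ≥ N, ∃ l ≥ N, V ≤ mean (rect k l) g x) (L : ℕ) :
    ∃ f : Torus2 → ℝ, Integrable f ∧ 0 ≤ f ∧ ∫ y, f y = L * ∫ y, g y ∧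
      ∃ E : Set Torus2, MeasurableSet E ∧ volume.real Eᶜ ≤ (1 - volume.real B) ^ L ∧
        ∀ x ∈ E, ∃ k ≥ N, ∃ l ≥ N, V ≤ mean (rect k l) f x := by
  induction L with
  | zero => exact ⟨0, integrable_zero _ _ _, le_rfl, by simp, ∅, MeasurableSet.empty, by simp,
      fun x hx => hx.elim⟩
  | succ L ih =>
    obtain ⟨f, hf, hf0, hfi, E, hE, hEv, hfE⟩ := ih
    obtain ⟨τ, hτ⟩ := exists_translate_measureReal_diff_le hE.compl hB
    have hgτ : Integrable (fun y => g (y - τ)) := hg.comp_sub_right τ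
    have hle1 : f ≤ fun y => f y + g (y - τ) := fun y => le_add_of_nonneg_right (hg0 _)
    have hle2 : (fun y => g (y - τ)) ≤ fun y => f y + g (y - τ) :=
      fun y => le_add_of_nonneg_left (hf0 _)
    refine ⟨fun y => f y + g (y - τ), hf.add hgτ, fun y => add_nonneg (hf0 _) (hg0 _), ?_,
      E ∪ {x | x - τ ∈ B}, hE.union ((measurable_id.sub_const τ) hB), ?_, ?_⟩
    · rw [integral_add hf hgτ, hfi, integral_sub_right_eq_self g τ]
      push_cast
      ring
    · rw [Set.compl_union, ← Set.sdiff_eq, pow_succ]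
      exact hτ.trans (mul_le_mul_of_nonneg_right hEv
        (sub_nonneg.2 measureReal_le_one))
    · rintro x (hx | hx)
      · obtain ⟨k, hk, l, hl, h⟩ := hfE x hx
        exact ⟨k, hk, l, hl, h.trans (mean_mono (measurableSet_rect k l) hf (hf.add hgτ)
          (Eventually.of_forall hle1) x)⟩
      · obtain ⟨k, hk, l, hl, h⟩ := hgB _ hx
        refine ⟨k, hk, l, hl, h.trans ?_⟩
        rw [← mean_comp_sub]
        exact mean_mono (measurableSet_rect k l) hgτ (hf.add hgτ) (Eventually.of_forall hle2) x

/-- A function of small integral with large averages off a set of small measure. -/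
lemma exists_small_integral_large_mean (N : ℕ) {V ε : ℝ} (hV : 0 ≤ V) (hε : 0 < ε) :
    ∃ f : Torus2 → ℝ, Integrable f ∧ 0 ≤ f ∧ ∫ y, f y ≤ ε ∧
      ∃ E : Set Torus2, MeasurableSet E ∧ volume.real Eᶜ ≤ ε ∧
        ∀ x ∈ E, ∃ k ≥ N, ∃ l ≥ N, V ≤ mean (rect k l) f x := by
  -- With `⌈a / b⌉₊` translates of a set of measure at least `b`, the uncovered part is at most `(1
  -- - b) ^ ⌈a / b⌉₊ ≤ exp (-a)`.
  obtain ⟨a, ha, hae⟩ : ∃ a : ℝ, 0 < a ∧ Real.exp (-a) ≤ ε := by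
    obtain ⟨a, h1, h2⟩ := ((Real.tendsto_exp_neg_atTop_nhds_zero.eventually_le_const hε).and
      (eventually_gt_atTop 0)).exists
    exact ⟨a, h2, h1⟩
  -- The total mass is at most `(4 * a + 1) * V / M`: `4 * a` from `a / b` copies, `1` from rounding
  -- up.
  obtain ⟨M, hM⟩ := exists_nat_gt ((4 * a + 1) * V / ε)
  have hM0 : (0 : ℝ) < M := lt_of_le_of_lt (by positivity) hM
  rw [div_lt_iff₀ hε] at hM
  set m := 2 * N + M with hm
  set b : ℝ := M * (2 : ℝ)⁻¹ ^ (m + 2) with hb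
  have hb0 : 0 < b := by positivity
  obtain ⟨f, hf, hf0, hfi, E, hE, hEv, hfE⟩ := exists_sum_translates
    (g := fun y => V * (2 : ℝ)⁻¹ ^ m * normalizedIndicator (rect (m + 1) (m + 1)) y)
    ((integrable_normalizedIndicator (measurableSet_rect _ _)).const_mul _)
    (fun y => mul_nonneg (by positivity) (normalizedIndicator_nonneg _ _))
    (measurableSet_hyperbolicCross N M) (N := N) (V := V) (fun x hx => by
      obtain ⟨k, hk, l, hl, h⟩ := exists_mean_rect_eq hx
      refine ⟨k, hk, l, hl, ?_⟩
      rw [mean_const_mul, h, mul_assoc, ← mul_pow]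
      norm_num) ⌈a / b⌉₊
  refine ⟨f, hf, hf0, ?_, E, hE, ?_, hfE⟩
  · rw [hfi, integral_const_mul, integral_normalizedIndicator_rect, mul_one]
    have hL : (⌈a / b⌉₊ : ℝ) ≤ a / b + 1 := (Nat.ceil_lt_add_one (by positivity)).le
    have hMm : (2 : ℝ)⁻¹ ^ m ≤ 1 / M := by
      rw [inv_pow, ← one_div]
      refine one_div_le_one_div_of_le hM0 ?_
      exact_mod_cast (show M ≤ m by omega).trans Nat.lt_two_pow_self.le
    have hab : a / b * (2 : ℝ)⁻¹ ^ m = 4 * a / M := by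
      rw [hb, pow_add]
      field_simp
      norm_num
    calc (⌈a / b⌉₊ : ℝ) * (V * (2 : ℝ)⁻¹ ^ m) ≤ (a / b + 1) * (V * (2 : ℝ)⁻¹ ^ m) := by gcongr
      _ = V * (a / b * (2 : ℝ)⁻¹ ^ m + (2 : ℝ)⁻¹ ^ m) := by ring
      _ ≤ V * (4 * a / M + 1 / M) := by rw [hab]; gcongr
      _ = (4 * a + 1) * V / M := by ring
      _ ≤ ε := by rw [div_le_iff₀ hM0]; linarith
  · calc volume.real Eᶜ ≤ (1 - volume.real (hyperbolicCross N M)) ^ ⌈a / b⌉₊ := hEv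
      _ ≤ (Real.exp (-b)) ^ ⌈a / b⌉₊ := by
        refine pow_le_pow_left₀ (sub_nonneg.2 measureReal_le_one) ?_ _
        have := Real.add_one_le_exp (-b)
        have : b ≤ _ := le_volume_hyperbolicCross N M
        linarith
      _ = Real.exp (-(⌈a / b⌉₊ * b)) := by rw [← Real.exp_nat_mul]; ring_nf
      _ ≤ Real.exp (-a) := by
        refine Real.exp_le_exp.2 (neg_le_neg ?_)
        rw [← div_le_iff₀ hb0]
        exact Nat.le_ceil _
      _ ≤ ε := hae

/-! ### Divergence of strong averages and conclusion -/

/-- The strong maximal averages of some integrable function diverge on a set of positive measure. -/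
lemma exists_integrable_unbounded_mean :
    ∃ f : Torus2 → ℝ, Integrable f ∧ ∃ E : Set Torus2, MeasurableSet E ∧ 0 < volume E ∧
      ∀ x ∈ E, ∀ (N : ℕ) (V : ℝ), ∃ k ≥ N, ∃ l ≥ N, V ≤ mean (rect k l) f x := by
  -- The tolerances sum to `1 / 2`: the total mass is finite and the exceptional sets cannot fill
  -- the torus.
  choose F hF hF0 hFi E hE hEv hFE using fun j : ℕ =>
    exists_small_integral_large_mean j (V := j) (ε := (1 / 4) * (1 / 2) ^ j) j.cast_nonneg
      (by positivity)
  have hsum : HasSum (fun j : ℕ => (1 / 4 : ℝ) * (1 / 2) ^ j) (1 / 2) := by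
    have := hasSum_geometric_two.mul_left (1 / 4 : ℝ)
    norm_num at this ⊢
    exact this
  have htsum : ∑' j : ℕ, ENNReal.ofReal ((1 / 4 : ℝ) * (1 / 2) ^ j) = ENNReal.ofReal (1 / 2) := by
    rw [← ENNReal.ofReal_tsum_of_nonneg (fun j => by positivity) hsum.summable, hsum.tsum_eq]
  have hmeas : ∀ j, AEMeasurable (fun x => ENNReal.ofReal (F j x)) volume := fun j =>
    (hF j).aestronglyMeasurable.aemeasurable.ennreal_ofReal
  set G : Torus2 → ℝ≥0∞ := fun x => ∑' j, ENNReal.ofReal (F j x) with hG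
  have hGm : AEMeasurable G volume := AEMeasurable.tsum hmeas
  have hGi : ∫⁻ x, G x ≠ ∞ := by
    rw [hG, lintegral_tsum hmeas]
    refine ne_top_of_le_ne_top (b := ENNReal.ofReal (1 / 2)) ENNReal.ofReal_ne_top ?_
    rw [← htsum]
    refine ENNReal.tsum_le_tsum fun j => ?_
    rw [← ofReal_integral_eq_lintegral_ofReal (hF j) (Eventually.of_forall (hF0 j))]
    exact ENNReal.ofReal_le_ofReal (hFi j)
  have hGint : Integrable (fun x => (G x).toReal) := integrable_toReal_of_lintegral_ne_top hGm hGi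
  have hle : ∀ j, F j ≤ᵐ[volume] fun x => (G x).toReal := by
    intro j
    filter_upwards [ae_lt_top' hGm hGi] with x hx
    rw [← ENNReal.toReal_ofReal (hF0 j x)]
    exact ENNReal.toReal_mono hx.ne (ENNReal.le_tsum j)
  refine ⟨_, hGint, ⋂ j, E j, MeasurableSet.iInter hE, ?_, ?_⟩
  · have hc : volume (⋂ j, E j)ᶜ ≤ ENNReal.ofReal (1 / 2) := by
      rw [Set.compl_iInter, ← htsum]
      refine (measure_iUnion_le _).trans (ENNReal.tsum_le_tsum fun j => ?_)
      rw [← ofReal_measureReal]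
      exact ENNReal.ofReal_le_ofReal (hEv j)
    rw [pos_iff_ne_zero]
    intro h0
    have := prob_compl_eq_one_sub (μ := (volume : Measure Torus2)) (MeasurableSet.iInter hE)
    rw [h0, tsub_zero] at this
    rw [this, ENNReal.one_le_ofReal] at hc
    norm_num at hc
  · intro x hx N V
    obtain ⟨j, hj⟩ := exists_nat_ge V
    obtain ⟨k, hk, l, hl, h⟩ := hFE (max j N) x (Set.mem_iInter.1 hx _)
    refine ⟨k, (le_max_right _ _).trans hk, l, (le_max_right _ _).trans hl, hj.trans ?_⟩
    refine le_trans ?_ (h.trans (mean_mono (measurableSet_rect k l) (hF _) hGint (hle _) x))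
    exact_mod_cast le_max_left j N

lemma limsup_enorm_bilinearOp_eq_top (𝕜 : Type*) [RCLike 𝕜] {f : Torus2 → ℝ} (hf : Integrable f)
    {x : Torus2}
    (hx : ∀ (N : ℕ) (V : ℝ), ∃ k ≥ N, ∃ l ≥ N, V ≤ mean (rect k l) f x)
    (hs : Tendsto (fun p : ℕ × ℕ => mean (square p.1 p.2) f x) minAtTop (𝓝 (f x))) :
    limsup (fun p : ℕ × ℕ =>
      ‖bilinearOp p.1 p.2 (fun y => (f y : 𝕜)) (fun y => (f y : 𝕜)) x‖ₑ) minAtTop = ⊤ := by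
  refine ENNReal.eq_top_of_forall_nnreal_le fun r => ?_
  refine le_limsup_of_frequently_le' ?_
  -- Square averages are eventually at most `f x + 1`, which leaves a difference of at least `r +
  -- 1`, with square at least `r`.
  have hrect : ∃ᶠ p : ℕ × ℕ in minAtTop, f x + 1 + (r + 1) ≤ mean (rect p.1 p.2) f x := by
    rw [minAtTop, (atTop_basis.comap fun p : ℕ × ℕ => min p.1 p.2).frequently_iff]
    intro N _
    obtain ⟨k, hk, l, hl, h⟩ := hx N (f x + 1 + (r + 1))
    exact ⟨(k, l), le_min hk hl, h⟩
  refine (hrect.and_eventually (hs.eventually_le_const (lt_add_one (f x)))).mono ?_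
  rintro ⟨k, l⟩ ⟨h1, h2⟩
  have hd : (r : ℝ) + 1 ≤ mean (rect k l) f x - mean (square k l) f x := by
    simp only at h1 h2
    linarith
  rw [bilinearOp_ofReal k l hf hf]
  refine ENNReal.coe_le_coe.2 ?_
  rw [← NNReal.coe_le_coe, coe_nnnorm, RCLike.norm_ofReal]
  refine le_trans ?_ (le_abs_self _)
  have hr : (0 : ℝ) ≤ r := r.2
  nlinarith

instance : minAtTop.NeBot := by
  refine comap_neBot fun s hs => ?_
  obtain ⟨n, hn⟩ := mem_atTop_sets.1 hs
  exact ⟨(n, n), hn _ (by simp)⟩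

end TorusAverages

open TorusAverages in
theorem mainTheorem8 (𝕜 : Type*) [RCLike 𝕜] :
    ∃ f₀ h₀ : TorusAverages.Torus2 → 𝕜,
      MeasureTheory.Integrable f₀ MeasureTheory.volume ∧
      MeasureTheory.Integrable h₀ MeasureTheory.volume ∧
      (∃ E : Set TorusAverages.Torus2, MeasurableSet E ∧ 0 < MeasureTheory.volume E ∧
        ∀ x ∈ E,
          Filter.limsup (fun p : ℕ × ℕ => ‖TorusAverages.bilinearOp p.1 p.2 f₀ h₀ x‖ₑ)
            TorusAverages.minAtTop = ⊤) ∧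
      ¬ (∀ᵐ x ∂(MeasureTheory.volume : MeasureTheory.Measure TorusAverages.Torus2),
          Filter.Tendsto (fun p : ℕ × ℕ => TorusAverages.bilinearOp p.1 p.2 f₀ h₀ x)
            TorusAverages.minAtTop (nhds 0)) := by
  obtain ⟨f, hf, E, hE, hE0, hfE⟩ := exists_integrable_unbounded_mean
  -- A measurable null set containing all points where square averages fail to converge, so that `E
  -- \ S` stays measurable.
  obtain ⟨S, hSsub, hSm, hS0⟩ := MeasureTheory.exists_measurable_superset_of_null
    (MeasureTheory.ae_iff.1 (ae_tendsto_mean_square hf))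
  have hES : 0 < MeasureTheory.volume (E \ S) := by
    rwa [MeasureTheory.measure_sdiff_null hS0]
  have hlim := fun x (hx : x ∈ E \ S) => limsup_enorm_bilinearOp_eq_top 𝕜 hf (hfE x hx.1)
    (not_not.1 fun h => hx.2 (hSsub h))
  refine ⟨fun y => (f y : 𝕜), fun y => (f y : 𝕜), hf.ofReal, hf.ofReal,
    ⟨E \ S, hE.diff hSm, hES, hlim⟩, fun hae => hES.ne' ?_⟩
  refine MeasureTheory.measure_mono_null ?_ (MeasureTheory.ae_iff.1 hae)
  intro x hx htend
  have h := hlim x hx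
  rw [htend.enorm.limsup_eq, enorm_zero] at h
  exact ENNReal.zero_ne_top h
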